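/- Let $\mu_0(\mathbf r)=\sum_{\mathbf k} c[\mathbf k]\,e^{2\pi i\,\mathbf k\cdot\mathbf r}$ be a nonzero trigonometric polynomial in two variables with finitely many frequencies $\mathbf k\in\mathbb Z^2$ and complex coefficients, and let $\{\mu_0=0\}\subset[0,1]^2$ be its zero set (the edge curve). Let $\Lambda_1=\{-n,\dots,n\}^2\subset\mathbb Z^2$, $n\ge 0$, be a square filter support symmetric around the origin, of size $\sqrt{|\Lambda_1|}\times\sqrt{|\Lambda_1|}$ with $\sqrt{|\Lambda_1|}=2n+1$. For a tuple $P=(\mathbf r_1,\dots,\mathbf r_R)$ of points let $\mathbf E(P)$ be the $|\Lambda_1|\times R$ matrix with entries $|\Lambda_1|^{-1/2}e^{2\pi i\,\mathbf k\cdot\mathbf r_j}$ ($\mathbf k\in\Lambda_1$, $1\le j\le R$), let $\mathbf G(P)=\mathbf E(P)^*\mathbf E(P)$ be its Gram matrix, and for $R\ge 1$ put $$\rho_R=\inf\Bigl\{\frac{1}{\lambda_{\min}[\mathbf G(P)]}\;:\;P\subset\{\mu_0=0\},\ |P|=R\Bigr\}\in[0,\infty],$$ with $1/0=\infty$ and $\inf\emptyset=\infty$.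 If $\mu_0$ is bandlimited to a finite set $\Lambda_0\subset\mathbb Z^2$ (that is, $c$ is supported in $\Lambda_0$), the incoherence measure of the edge curve is $\rho=\rho_R$ for $R=|\Lambda_1|-|\Lambda_1:\Lambda_0|$, where $|\Lambda_1:\Lambda_0|$ is the number of integer shifts of $\Lambda_0$ contained in $\Lambda_1$. Let $R\ge 1$, let $\Delta$ be a real number with $\sqrt{|\Lambda_1|}\,\Delta>1$, and suppose that there are points $(x_1,y_1),\dots,(x_R,y_R)$ on the curve $\{\mu_0=0\}$ such that for all $i\ne j$ both $x_i,x_j$ and $y_i,y_j$ are more than $\Delta$ apart modulo $1$, i.e. $|x_i-x_j-m|>\Delta$ and $|y_i-y_j-m|>\Delta$ for every $m\in\mathbb Z$. Then $$\rho_R\le\Bigl(1-\frac{1}{\sqrt{|\Lambda_1|}\,\Delta}\Bigr)^{-2}.$$ In particular, if $R=|\Lambda_1|-|\Lambda_1:\Lambda_0|$ for a finite set $\Lambda_0$ to which $\mu_0$ is bandlimited, then the incoherence measure $\rho$ satisfies $$\rho\le\Bigl(1-\frac{1}{\sqrt{|\Lambda_1|}\,\Delta}\Bigr)^{-2}.$$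 -/

import Mathlib

open scoped ENNReal Matrix

noncomputable section

namespace EdgeIncoherence

/-- The character `r ↦ exp(2πi k·r)` of frequency `k ∈ ℤ²`. -/
def expMode (k : ℤ × ℤ) (r : ℝ × ℝ) : ℂ :=
  Complex.exp (2 * (Real.pi : ℂ) * Complex.I * ((k.1 * r.1 + k.2 * r.2 : ℝ) : ℂ))

/-- The trigonometric polynomial `μ(r) = ∑ₖ c[k] exp(2πi k·r)` with Fourier coefficients `c`. -/
def trigPoly (c : (ℤ × ℤ) →₀ ℂ) (r : ℝ × ℝ) : ℂ :=
  ∑ k ∈ c.support, c k * expMode k r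

/-- The edge set `{μ = 0}`, as a subset of the unit square `[0,1]²`. -/
def edgeSet (c : (ℤ × ℤ) →₀ ℂ) : Set (ℝ × ℝ) :=
  {r | r.1 ∈ Set.Icc (0 : ℝ) 1 ∧ r.2 ∈ Set.Icc (0 : ℝ) 1 ∧ trigPoly c r = 0}

/-- The square index set `{-n, …, n}²`; these are exactly the (nonempty) square regions of `ℤ²`
that are symmetric around the origin, and the side length is `2n + 1`. -/
def symmSquare (n : ℕ) : Finset (ℤ × ℤ) :=
  Finset.Icc (-(n : ℤ)) n ×ˢ Finset.Icc (-(n : ℤ)) n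

/-- The normalized Vandermonde-like matrix with entries `|Λ|^{-1/2} exp(2πi k·rⱼ)`, with rows
indexed by `k ∈ Λ` and columns by the nodes `r₁, …, r_R`. -/
def vandermondeRow (Λ : Finset (ℤ × ℤ)) {R : ℕ} (p : Fin R → ℝ × ℝ) : Matrix Λ (Fin R) ℂ :=
  Matrix.of fun k j => ((1 / Real.sqrt (Λ.card : ℝ) : ℝ) : ℂ) * expMode k.1 (p j)

/-- The Gram matrix `G(P) = E_row(P)* E_row(P)`. -/
def gram (Λ : Finset (ℤ × ℤ)) {R : ℕ} (p : Fin R → ℝ × ℝ) : Matrix (Fin R) (Fin R) ℂ :=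
  (vandermondeRow Λ p)ᴴ * vandermondeRow Λ p

theorem gram_isHermitian (Λ : Finset (ℤ × ℤ)) {R : ℕ} (p : Fin R → ℝ × ℝ) :
    (gram Λ p).IsHermitian :=
  Matrix.isHermitian_conjTranspose_mul_self (vandermondeRow Λ p)

/-- The smallest eigenvalue of `G(P)` (meaningful for `R ≥ 1`). -/
def lambdaMin (Λ : Finset (ℤ × ℤ)) {R : ℕ} (p : Fin R → ℝ × ℝ) : ℝ :=
  ⨅ i, (gram_isHermitian Λ p).eigenvalues i

/-- `min 1 / λ_min[G(P)]` over all sets `P` of `R` distinct points of the edge set `{μ = 0}`, as an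
infimum in `[0, ∞]`. Here `1 / 0 = ∞`, and the value is `∞` if the edge set has fewer than `R`
points. -/
def incoherenceOfSize (c : (ℤ × ℤ) →₀ ℂ) (Λ₁ : Finset (ℤ × ℤ)) (R : ℕ) : ℝ≥0∞ :=
  ⨅ (p : Fin R → ℝ × ℝ) (_ : Function.Injective p) (_ : ∀ i, p i ∈ edgeSet c),
    (ENNReal.ofReal (lambdaMin Λ₁ p))⁻¹

/-- `|Λ₁ : Λ₀|`, the number of integer shifts of `Λ₀` contained in `Λ₁`
(for a nonempty `Λ₀`, so that this number is finite and at most `|Λ₁|`). -/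
def shiftCount (Λ₁ Λ₀ : Finset (ℤ × ℤ)) : ℕ :=
  Set.ncard {m : ℤ × ℤ | ∀ k ∈ Λ₀, k + m ∈ Λ₁}

/-- `|Λ₁| - |Λ₁ : Λ₀|`. -/
def nodeCount (Λ₁ Λ₀ : Finset (ℤ × ℤ)) : ℕ :=
  Λ₁.card - shiftCount Λ₁ Λ₀

/-- The incoherence measure `ρ` of the edge set `{μ = 0}` with bandwidth `Λ₀` for the filter
support `Λ₁`: the sets `P` have `|Λ₁| - |Λ₁ : Λ₀|` points. -/
def incoherence (c : (ℤ × ℤ) →₀ ℂ) (Λ₀ Λ₁ : Finset (ℤ × ℤ)) : ℝ≥0∞ :=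
  incoherenceOfSize c Λ₁ (nodeCount Λ₁ Λ₀)

/-- Two real numbers are more than `Δ` apart modulo 1 (wrap-around distance). -/
def FarModOne (Δ a b : ℝ) : Prop :=
  ∀ m : ℤ, Δ < |a - b - m|

end EdgeIncoherence

end

namespace EdgeIncoherence

/-! With N = 2n+1, the Gram entries over the square support factor as D(x_j - x_i) D(y_j - y_i) /
N², D being the Dirichlet kernel, so the diagonal is 1. Since |D(x)| ≤ 1/(2 dist(x, ℤ)), separation
modulo 1 bounds the sum of |D|² over j ≠ i by 1/Δ² in each coordinate
(`sum_norm_dirichletKernel_sq_le`). As |ab| ≤ (|a|² + |b|²)/2, every off-diagonal row sum is at most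
t², where t = 1/(NΔ) < 1. Gershgorin's theorem then gives λ_min ≥ 1 - t² ≥ (1 - t)², and the given
nodes are a competitor in the infimum. -/

/-- The Dirichlet kernel `∑_{|k| ≤ n} exp(2πi k x)`. -/
noncomputable def dirichletKernel (n : ℕ) (x : ℝ) : ℂ :=
  ∑ k ∈ Finset.Icc (-(n : ℤ)) n, Complex.exp (2 * (Real.pi : ℂ) * Complex.I * ((k * x : ℝ) : ℂ))

theorem norm_exp_two_pi_I_mul_ofReal (x : ℝ) :
    ‖Complex.exp (2 * (Real.pi : ℂ) * Complex.I * (x : ℂ))‖ = 1 := by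
  rw [show 2 * (Real.pi : ℂ) * Complex.I * (x : ℂ) = ((2 * Real.pi * x : ℝ) : ℂ) * Complex.I by
    push_cast; ring]
  exact Complex.norm_exp_ofReal_mul_I _

theorem dirichletKernel_mul_exp (n : ℕ) (x : ℝ) :
    dirichletKernel n x * Complex.exp (2 * (Real.pi : ℂ) * Complex.I * ((n * x : ℝ) : ℂ)) =
      ∑ j ∈ Finset.range (2 * n + 1), Complex.exp (2 * (Real.pi : ℂ) * Complex.I * (x : ℂ)) ^ j := by
  rw [dirichletKernel, Finset.sum_mul]
  refine Finset.sum_nbij' (fun k => (k + n).toNat) (fun j => (j : ℤ) - n) ?_ ?_ ?_ ?_ ?_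
  · intro k hk
    simp only [Finset.mem_Icc, Finset.mem_range] at *
    omega
  · intro k hk
    simp only [Finset.mem_Icc, Finset.mem_range] at *
    omega
  · intro k hk
    simp only [Finset.mem_Icc] at *
    omega
  · intro k hk
    simp
  · intro k hk
    have hk' : ((k + n).toNat : ℤ) = k + n := by
      simp only [Finset.mem_Icc] at hk
      omega
    have hc : (((k + n).toNat : ℕ) : ℂ) = k + n := by exact_mod_cast hk'
    rw [← Complex.exp_add, ← Complex.exp_nat_mul, hc]
    congr 1
    push_cast
    ring

/-- The right side is 2|sin πx|, which has period 1; Jordan's inequality |sin θ| ≥ 2|θ|/π applies at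
θ = π(x - round x), where |θ| ≤ π/2. -/
theorem four_mul_abs_sub_round_le (x : ℝ) :
    4 * |x - round x| ≤ ‖Complex.exp (2 * (Real.pi : ℂ) * Complex.I * (x : ℂ)) - 1‖ := by
  have hpi := Real.pi_pos
  rw [show 2 * (Real.pi : ℂ) * Complex.I * (x : ℂ) = Complex.I * ((2 * Real.pi * x : ℝ) : ℂ) by
    push_cast; ring, Complex.norm_exp_I_mul_ofReal_sub_one]
  have h := Real.mul_abs_le_abs_sin (x := Real.pi * (x - round x)) (by
    rw [abs_mul, abs_of_pos hpi]
    nlinarith [abs_sub_round x])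
  have h2 : |Real.sin (Real.pi * (x - round x))| = |Real.sin (Real.pi * x)| := by
    rw [mul_sub, mul_comm Real.pi (round x : ℝ), Real.sin_sub_int_mul_pi, abs_mul]
    simp
  rw [h2, abs_mul, abs_of_pos hpi, ← mul_assoc, div_mul_cancel₀ _ hpi.ne'] at h
  rw [show 2 * Real.pi * x / 2 = Real.pi * x by ring, Real.norm_eq_abs, abs_mul, abs_two]
  linarith

/-- Up to a unimodular factor the kernel is a geometric sum, so multiplying it by z - 1 gives
z^(2n+1) - 1, of norm at most 2. The product form also covers integer x. -/
theorem norm_dirichletKernel_mul_le (n : ℕ) (x : ℝ) :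
    ‖dirichletKernel n x‖ * (2 * |x - round x|) ≤ 1 := by
  set z := Complex.exp (2 * (Real.pi : ℂ) * Complex.I * (x : ℂ)) with hz
  have h1 : ‖dirichletKernel n x‖ * ‖z - 1‖ ≤ 2 := by
    have h := congrArg norm (dirichletKernel_mul_exp n x)
    rw [norm_mul, norm_exp_two_pi_I_mul_ofReal, mul_one] at h
    rw [h, ← norm_mul, geom_sum_mul]
    refine (norm_sub_le _ _).trans ?_
    rw [norm_pow, norm_exp_two_pi_I_mul_ofReal]
    norm_num
  have h2 := mul_le_mul_of_nonneg_left (four_mul_abs_sub_round_le x)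
    (norm_nonneg (dirichletKernel n x))
  linarith

theorem norm_dirichletKernel_sq_le (n : ℕ) {x : ℝ} (hx : 0 < |x - round x|) :
    ‖dirichletKernel n x‖ ^ 2 ≤ 1 / 4 * (1 / (x - round x) ^ 2) := by
  have h := norm_dirichletKernel_mul_le n x
  rw [← le_div_iff₀ (by positivity)] at h
  refine (pow_le_pow_left₀ (norm_nonneg _) h 2).trans_eq ?_
  rw [div_pow, mul_pow, sq_abs, one_div_mul_one_div]
  norm_num

/-- The sum of inverse squares over points of `(Δ, ∞)` that are more than `Δ` apart; the map
`u ↦ ⌊u / Δ⌋` compares it with `∑ 1 / m ^ 2`. -/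
theorem sum_one_div_sq_le_of_pos {ι : Type*} (s : Finset ι) (u : ι → ℝ) {Δ : ℝ} (hΔ : 0 < Δ)
    (hpos : ∀ j ∈ s, Δ < u j) (hsep : ∀ j ∈ s, ∀ k ∈ s, j ≠ k → Δ < |u j - u k|) :
    ∑ j ∈ s, 1 / u j ^ 2 ≤ 2 / Δ ^ 2 := by
  set f : ι → ℕ := fun j => ⌊u j / Δ⌋₊ with hf
  have hu : ∀ j ∈ s, 0 < u j := fun j hj => hΔ.trans (hpos j hj)
  have hinj : Set.InjOn f s := by
    intro j hj k hk hjk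
    by_contra hne
    have h := hsep j hj k hk hne
    have hj1 := Nat.floor_le (div_nonneg (hu j hj).le hΔ.le)
    have hj2 := Nat.lt_floor_add_one (u j / Δ)
    have hk1 := Nat.floor_le (div_nonneg (hu k hk).le hΔ.le)
    have hk2 := Nat.lt_floor_add_one (u k / Δ)
    have hjk' : ⌊u j / Δ⌋₊ = ⌊u k / Δ⌋₊ := hjk
    rw [hjk'] at hj1 hj2
    have h3 : |u j / Δ - u k / Δ| < 1 := abs_lt.2 ⟨by linarith, by linarith⟩
    rw [← sub_div, abs_div, abs_of_pos hΔ, div_lt_one hΔ] at h3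
    linarith
  have hterm : ∀ j ∈ s, 1 / u j ^ 2 ≤ 1 / Δ ^ 2 * (1 / (f j : ℝ) ^ 2) := by
    intro j hj
    -- The floor must avoid 0, where `1 / 0 = 0` would spoil the comparison.
    have h1 : 1 ≤ f j := Nat.le_floor (by
      rw [Nat.cast_one, one_le_div hΔ]
      exact (hpos j hj).le)
    have h1' : (0 : ℝ) < f j := by exact_mod_cast h1
    have h2 : f j ≤ u j / Δ := Nat.floor_le (div_nonneg (hu j hj).le hΔ.le)
    rw [le_div_iff₀ hΔ] at h2
    rw [one_div_mul_one_div, ← mul_pow]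
    refine one_div_le_one_div_of_le (by positivity) ?_
    gcongr
    linarith
  calc ∑ j ∈ s, 1 / u j ^ 2 ≤ ∑ j ∈ s, 1 / Δ ^ 2 * (1 / (f j : ℝ) ^ 2) := Finset.sum_le_sum hterm
    _ = 1 / Δ ^ 2 * ∑ m ∈ s.image f, 1 / (m : ℝ) ^ 2 := by
        rw [← Finset.mul_sum, Finset.sum_image hinj]
    _ ≤ 1 / Δ ^ 2 * (Real.pi ^ 2 / 6) := by
        gcongr
        exact sum_le_hasSum _ (fun _ _ => by positivity) hasSum_zeta_two
    _ ≤ 1 / Δ ^ 2 * 2 := by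
        gcongr
        -- The crude π²/6 ≤ 2 suffices: both signs together give 4, which cancels the 1/4 from the
        -- kernel bound.
        nlinarith [Real.pi_pos, Real.pi_lt_d2]
    _ = 2 / Δ ^ 2 := by ring

theorem sum_one_div_sq_le {ι : Type*} (s : Finset ι) (u : ι → ℝ) {Δ : ℝ} (hΔ : 0 < Δ)
    (habs : ∀ j ∈ s, Δ < |u j|) (hsep : ∀ j ∈ s, ∀ k ∈ s, j ≠ k → Δ < |u j - u k|) :
    ∑ j ∈ s, 1 / u j ^ 2 ≤ 4 / Δ ^ 2 := by
  have h1 := sum_one_div_sq_le_of_pos (s.filter fun j => 0 ≤ u j) u hΔ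
    (fun j hj => by
      rw [Finset.mem_filter] at hj
      simpa only [abs_of_nonneg hj.2] using habs j hj.1)
    (fun j hj k hk => hsep j (Finset.mem_filter.1 hj).1 k (Finset.mem_filter.1 hk).1)
  have h2 := sum_one_div_sq_le_of_pos (s.filter fun j => ¬ 0 ≤ u j) (fun j => -u j) hΔ
    (fun j hj => by
      rw [Finset.mem_filter, not_le] at hj
      simpa only [abs_of_neg hj.2] using habs j hj.1)
    (fun j hj k hk hne => by
      rw [neg_sub_neg, abs_sub_comm]
      exact hsep j (Finset.mem_filter.1 hj).1 k (Finset.mem_filter.1 hk).1 hne)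
  simp only [neg_sq] at h2
  rw [← Finset.sum_filter_add_sum_filter_not s fun j => 0 ≤ u j]
  calc _ ≤ 2 / Δ ^ 2 + 2 / Δ ^ 2 := add_le_add h1 h2
    _ = 4 / Δ ^ 2 := by ring

theorem sum_norm_dirichletKernel_sq_le (n : ℕ) {ι : Type*} [Fintype ι] [DecidableEq ι]
    (x : ι → ℝ) {Δ : ℝ} (hΔ : 0 < Δ) (hx : ∀ i j, i ≠ j → FarModOne Δ (x i) (x j)) (i : ι) :
    ∑ j ∈ Finset.univ.erase i, ‖dirichletKernel n (x j - x i)‖ ^ 2 ≤ 1 / Δ ^ 2 := by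
  set u : ι → ℝ := fun j => x j - x i - round (x j - x i) with hu
  have habs : ∀ j ∈ Finset.univ.erase i, Δ < |u j| := fun j hj =>
    hx j i (Finset.ne_of_mem_erase hj) _
  have hsep : ∀ j ∈ Finset.univ.erase i, ∀ k ∈ Finset.univ.erase i, j ≠ k → Δ < |u j - u k| := by
    intro j _ k _ hjk
    have h := hx j k hjk (round (x j - x i) - round (x k - x i))
    -- Reducing to nearest representatives changes differences only by integers, so separation
    -- modulo 1 survives as ordinary separation on the line.
    rw [show u j - u k = x j - x k - ((round (x j - x i) - round (x k - x i) : ℤ) : ℝ) by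
      simp only [hu]; push_cast; ring]
    exact h
  calc _ ≤ ∑ j ∈ Finset.univ.erase i, 1 / 4 * (1 / u j ^ 2) :=
        Finset.sum_le_sum fun j hj => norm_dirichletKernel_sq_le n (hΔ.trans (habs j hj))
    _ = 1 / 4 * ∑ j ∈ Finset.univ.erase i, 1 / u j ^ 2 := by rw [Finset.mul_sum]
    _ ≤ 1 / 4 * (4 / Δ ^ 2) := by
        gcongr
        exact sum_one_div_sq_le _ u hΔ habs hsep
    _ = 1 / Δ ^ 2 := by ring

theorem card_symmSquare (n : ℕ) : (symmSquare n).card = (2 * n + 1) ^ 2 := by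
  rw [symmSquare, Finset.card_product, Int.card_Icc, sq]
  congr 1 <;> omega

theorem conj_expMode_mul_expMode (k : ℤ × ℤ) (r s : ℝ × ℝ) :
    star (expMode k r) * expMode k s =
      Complex.exp (2 * (Real.pi : ℂ) * Complex.I * ((k.1 * (s.1 - r.1) : ℝ) : ℂ)) *
        Complex.exp (2 * (Real.pi : ℂ) * Complex.I * ((k.2 * (s.2 - r.2) : ℝ) : ℂ)) := by
  rw [expMode, expMode, Complex.star_def, ← Complex.exp_conj, ← Complex.exp_add,
    ← Complex.exp_add]
  congr 1
  simp only [map_mul, Complex.conj_ofReal, Complex.conj_I, map_ofNat]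
  push_cast
  ring

theorem gram_symmSquare_apply (n : ℕ) {R : ℕ} (p : Fin R → ℝ × ℝ) (i j : Fin R) :
    gram (symmSquare n) p i j = (1 / (2 * n + 1) ^ 2 : ℂ) *
      (dirichletKernel n ((p j).1 - (p i).1) * dirichletKernel n ((p j).2 - (p i).2)) := by
  have hs : Real.sqrt ((symmSquare n).card : ℝ) = 2 * n + 1 := by
    rw [card_symmSquare]
    push_cast
    exact Real.sqrt_sq (by positivity)
  rw [gram, Matrix.mul_apply, dirichletKernel, dirichletKernel, Finset.sum_mul_sum,
    ← Finset.sum_product', ← symmSquare, Finset.mul_sum, ← Finset.sum_coe_sort (symmSquare n)]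
  refine Finset.sum_congr rfl fun k _ => ?_
  rw [← conj_expMode_mul_expMode, Matrix.conjTranspose_apply, vandermondeRow, Matrix.of_apply,
    Matrix.of_apply, hs, star_mul', Complex.star_def, Complex.conj_ofReal]
  push_cast
  rw [sq, ← one_div_mul_one_div]
  ring

theorem dirichletKernel_zero (n : ℕ) : dirichletKernel n 0 = 2 * n + 1 := by
  rw [dirichletKernel]
  simp only [mul_zero, Complex.ofReal_zero, Complex.exp_zero, Finset.sum_const, Int.card_Icc,
    nsmul_eq_mul, mul_one]
  rw [show ((n : ℤ) + 1 - -(n : ℤ)).toNat = 2 * n + 1 by omega]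
  push_cast
  ring

theorem gram_symmSquare_diag (n : ℕ) {R : ℕ} (p : Fin R → ℝ × ℝ) (i : Fin R) :
    gram (symmSquare n) p i i = 1 := by
  have h : (2 * n + 1 : ℂ) ≠ 0 := by exact_mod_cast (2 * n).succ_ne_zero
  rw [gram_symmSquare_apply, sub_self, sub_self, dirichletKernel_zero]
  field_simp

theorem sum_norm_gram_symmSquare_le (n : ℕ) {R : ℕ} (p : Fin R → ℝ × ℝ) {Δ : ℝ} (hΔ : 0 < Δ)
    (hx : ∀ i j, i ≠ j → FarModOne Δ (p i).1 (p j).1)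
    (hy : ∀ i j, i ≠ j → FarModOne Δ (p i).2 (p j).2) (i : Fin R) :
    ∑ j ∈ Finset.univ.erase i, ‖gram (symmSquare n) p i j‖ ≤ (1 / ((2 * n + 1) * Δ)) ^ 2 := by
  have h1 := sum_norm_dirichletKernel_sq_le n (fun j => (p j).1) hΔ hx i
  have h2 := sum_norm_dirichletKernel_sq_le n (fun j => (p j).2) hΔ hy i
  have hN : ‖(1 / (2 * n + 1) ^ 2 : ℂ)‖ = 1 / (2 * n + 1) ^ 2 := by
    rw [norm_div, norm_pow, norm_one]
    congr 2
    exact_mod_cast Complex.norm_natCast (2 * n + 1)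
  calc _ ≤ ∑ j ∈ Finset.univ.erase i, (1 / (2 * n + 1) ^ 2 : ℝ) *
          (1 / 2 * (‖dirichletKernel n ((p j).1 - (p i).1)‖ ^ 2 +
            ‖dirichletKernel n ((p j).2 - (p i).2)‖ ^ 2)) := by
        refine Finset.sum_le_sum fun j _ => ?_
        rw [gram_symmSquare_apply, norm_mul, norm_mul, hN]
        refine mul_le_mul_of_nonneg_left ?_ (by positivity)
        linarith [two_mul_le_add_sq ‖dirichletKernel n ((p j).1 - (p i).1)‖
          ‖dirichletKernel n ((p j).2 - (p i).2)‖]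
    _ = (1 / (2 * n + 1) ^ 2 : ℝ) * (1 / 2 *
          (∑ j ∈ Finset.univ.erase i, ‖dirichletKernel n ((p j).1 - (p i).1)‖ ^ 2 +
            ∑ j ∈ Finset.univ.erase i, ‖dirichletKernel n ((p j).2 - (p i).2)‖ ^ 2)) := by
        rw [← Finset.mul_sum, ← Finset.mul_sum, Finset.sum_add_distrib]
    _ ≤ (1 / (2 * n + 1) ^ 2 : ℝ) * (1 / 2 * (1 / Δ ^ 2 + 1 / Δ ^ 2)) := by gcongr
    _ = (1 / ((2 * n + 1) * Δ)) ^ 2 := by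
        field_simp
        norm_num

/-- A Gershgorin lower bound for the eigenvalues of a Hermitian matrix with unit diagonal. -/
theorem one_sub_le_eigenvalues {m : Type*} [Fintype m] [DecidableEq m] {A : Matrix m m ℂ}
    (hA : A.IsHermitian) (hdiag : ∀ i, A i i = 1) {b : ℝ}
    (hb : ∀ i, ∑ j ∈ Finset.univ.erase i, ‖A i j‖ ≤ b) (i : m) : 1 - b ≤ hA.eigenvalues i := by
  have hev : Module.End.HasEigenvalue (Matrix.toLin' A) (hA.eigenvalues i : ℂ) := by
    rw [Module.End.hasEigenvalue_iff_mem_spectrum, Matrix.spectrum_toLin']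
    exact (spectrum.algebraMap_mem_iff ℂ).2 (hA.eigenvalues_mem_spectrum_real i)
  obtain ⟨k, hk⟩ := eigenvalue_mem_ball hev
  rw [hdiag, mem_closedBall_iff_norm] at hk
  have h := (Complex.abs_re_le_norm _).trans (hk.trans (hb k))
  rw [Complex.sub_re, Complex.one_re] at h
  have h2 := (abs_le.1 h).1
  rw [Complex.ofReal_re] at h2
  linarith

theorem sq_one_sub_le_lambdaMin (n : ℕ) {R : ℕ} (hR : 0 < R) (p : Fin R → ℝ × ℝ) {Δ : ℝ}
    (hΔ : 1 < (2 * n + 1) * Δ)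
    (hx : ∀ i j, i ≠ j → FarModOne Δ (p i).1 (p j).1)
    (hy : ∀ i j, i ≠ j → FarModOne Δ (p i).2 (p j).2) :
    (1 - 1 / ((2 * n + 1) * Δ)) ^ 2 ≤ lambdaMin (symmSquare n) p := by
  have : Nonempty (Fin R) := ⟨⟨0, hR⟩⟩
  have hΔ0 : 0 < Δ := pos_of_mul_pos_right (one_pos.trans hΔ) (by positivity)
  refine le_ciInf fun i => ?_
  have h := one_sub_le_eigenvalues (gram_isHermitian (symmSquare n) p)
    (gram_symmSquare_diag n p) (sum_norm_gram_symmSquare_le n p hΔ0 hx hy) i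
  have ht0 : 0 < 1 / ((2 * n + 1) * Δ) := by positivity
  have ht1 : 1 / ((2 * n + 1) * Δ) < 1 := by rwa [div_lt_one (by positivity)]
  -- With t = 1/((2n+1)Δ) in (0, 1), (1 - t²) - (1 - t)² = 2t(1 - t) ≥ 0.
  nlinarith

end EdgeIncoherence

theorem theorem10 (n : ℕ) (Λ₁ : Finset (ℤ × ℤ)) (hΛ₁ : Λ₁ = EdgeIncoherence.symmSquare n)
    (c : (ℤ × ℤ) →₀ ℂ) (hc : c ≠ 0) (R : ℕ) (hR : 0 < R)
    (Δ : ℝ) (hΔ : 1 < Real.sqrt (Λ₁.card : ℝ) * Δ)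
    (p : Fin R → ℝ × ℝ) (hp : ∀ i, p i ∈ EdgeIncoherence.edgeSet c)
    (hx : ∀ i j, i ≠ j → EdgeIncoherence.FarModOne Δ (p i).1 (p j).1)
    (hy : ∀ i j, i ≠ j → EdgeIncoherence.FarModOne Δ (p i).2 (p j).2) :
    EdgeIncoherence.incoherenceOfSize c Λ₁ R ≤
        ENNReal.ofReal ((1 - 1 / (Real.sqrt (Λ₁.card : ℝ) * Δ)) ^ (-2 : ℤ)) ∧
      ∀ Λ₀ : Finset (ℤ × ℤ), c.support ⊆ Λ₀ → R = EdgeIncoherence.nodeCount Λ₁ Λ₀ →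
        EdgeIncoherence.incoherence c Λ₀ Λ₁ ≤
          ENNReal.ofReal ((1 - 1 / (Real.sqrt (Λ₁.card : ℝ) * Δ)) ^ (-2 : ℤ)) := by
  have hbound : EdgeIncoherence.incoherenceOfSize c Λ₁ R ≤
      ENNReal.ofReal ((1 - 1 / (Real.sqrt (Λ₁.card : ℝ) * Δ)) ^ (-2 : ℤ)) := by
    have hs : Real.sqrt (Λ₁.card : ℝ) = 2 * n + 1 := by
      rw [hΛ₁, EdgeIncoherence.card_symmSquare]
      push_cast
      exact Real.sqrt_sq (by positivity)
    rw [hs] at hΔ ⊢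
    subst hΛ₁
    have hΔ0 : 0 < Δ := pos_of_mul_pos_right (one_pos.trans hΔ) (by positivity)
    have hinj : Function.Injective p := by
      intro i j hij
      by_contra hne
      have h := hx i j hne 0
      rw [hij] at h
      simp only [sub_self, Int.cast_zero, abs_zero] at h
      linarith
    have ht1 : 1 / ((2 * n + 1) * Δ) < 1 := by rwa [div_lt_one (by positivity)]
    have hpos : 0 < (1 - 1 / ((2 * n + 1) * Δ)) ^ 2 := pow_pos (sub_pos.2 ht1) 2
    refine iInf_le_of_le p (iInf_le_of_le hinj (iInf_le_of_le hp ?_))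
    rw [zpow_neg, ENNReal.ofReal_inv_of_pos (by exact_mod_cast hpos), ENNReal.inv_le_inv]
    exact ENNReal.ofReal_le_ofReal
      (by exact_mod_cast EdgeIncoherence.sq_one_sub_le_lambdaMin n hR p hΔ hx hy)
  refine ⟨hbound, fun Λ₀ _ hRΛ => ?_⟩
  rw [EdgeIncoherence.incoherence, ← hRΛ]
  exact hbound
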